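/- For $r=1,2,3,\ldots$ let $$g_{2r}(x)=\sum_{s=0}^{r-1}\frac{(-1)^s}{2^s s!}\,\phi^{(2s)}(x),\qquad G_{2r}(x)=\int_{-\infty}^{x}g_{2r}(z)\,dz,$$ where $\phi$ is the standard normal density and $\phi^{(2s)}$ its derivative of order $2s$ (these are the Gaussian-based kernels of order $2r$ for the estimation of a density and of a distribution function). For a kernel $K(x)=\int_{-\infty}^{x}k(z)\,dz$ put $\psi_1(K)=2\int_{-\infty}^{\infty}xK(x)k(x)\,dx$, and let $C(r)=\sqrt{\pi}\,\psi_1(G_{2r})$. Then, as $r\to\infty$ through the positive integers, $$C(r)=\pi^{-1/2}(2r-2)^{-1/2}+\sqrt{2}\,\pi^{-1}(4r-3)^{-1}+O(r^{-3/2}),$$ and in particular $$\sqrt{2r-2}\;\psi_1(G_{2r})\to\frac{1}{\pi}.$$ -/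

import Mathlib

open Filter Asymptotics MeasureTheory

noncomputable section

/-- The standard normal density `φ`. -/
def stdNormalDensity : ℝ → ℝ := ProbabilityTheory.gaussianPDFReal 0 1

/-- The Gaussian-based density kernel `g_{2r}` of order `2r`
(`r = 1, 2, 3, …`): `g_{2r}(x) = ∑_{s=0}^{r-1} (-1)^s / (2^s s!) · φ^{(2s)}(x)`. -/
def gaussianKernel (r : ℕ) (x : ℝ) : ℝ :=
  ∑ s ∈ Finset.range r,
    (-1 : ℝ) ^ s / ((2 : ℝ) ^ s * (Nat.factorial s : ℝ)) *
      iteratedDeriv (2 * s) stdNormalDensity x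

/-- The distribution-function kernel `K(x) = ∫_{-∞}^x k(z) dz` of a density kernel `k`. -/
def integratedKernel (k : ℝ → ℝ) (x : ℝ) : ℝ := ∫ z in Set.Iic x, k z

/-- `ψ₁(K) = 2 ∫ x K(x) k(x) dx`, where `K` is the distribution-function kernel of `k`.
It is written as a function of `k`, which determines `K`. -/
def psiOne (k : ℝ → ℝ) : ℝ := 2 * ∫ x : ℝ, x * integratedKernel k x * k x

/-- `C(r) = √π · ψ₁(G_{2r})`, with `G_{2r}` the distribution-function kernel of `g_{2r}`. -/
def kernelConst (r : ℕ) : ℝ := Real.sqrt Real.pi * psiOne (gaussianKernel r)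

end

/-! The Hermite recurrence collapses `x * g_{2r}(x)` to one multiple of `φ^{(2r-1)}`. Integration by
parts then removes the primitive `G_{2r}`, and with `n = r - 1` this writes `C(n+1)` as a finite
hypergeometric sum (`kernelConst_succ_eq_sum`). Creative telescoping gives a first-order recurrence
(`kernelConst_recurrence`), whose homogeneous part is solved by `b_n = 4⁻ⁿ (2n choose n)`. Hence
`C(n+1) = b_n (1 - ∑_{i<n} a_{2i+1})`, where `a_j = b_j - b_{j+1}` and `1 - √(1-x) = ∑ a_j x^{j+1}`.

The values at `x = ±1` give `∑ a_{2i+1} = 1 - √2/2`, so `C(n+1) = b_n (√2/2 + t_n)` with `t_n` the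
tail of that series. Monotonicity of `a_j` puts `t_n` between `b_{2n+1}/2` and `b_{2n}/2`, and
Wallis bounds give `b_n ≈ (πn)^{-1/2}`. The two summands of the bracket yield the two terms of the
expansion. -/

/-! ### Derivatives of the normal density and their inner products. -/

theorem stdNormalDensity_apply (x : ℝ) :
    stdNormalDensity x = (Real.sqrt (2 * Real.pi))⁻¹ * Real.exp (-(1 / 2) * x ^ 2) := by
  unfold stdNormalDensity
  rw [ProbabilityTheory.gaussianPDFReal_def]
  simp only [NNReal.coe_one, mul_one, sub_zero]
  congr 2
  ring

theorem hasDerivAt_stdNormalDensity (x : ℝ) :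
    HasDerivAt stdNormalDensity (-(x * stdNormalDensity x)) x := by
  have h : stdNormalDensity =
      fun y => (Real.sqrt (2 * Real.pi))⁻¹ * Real.exp (-(1 / 2) * y ^ 2) :=
    funext stdNormalDensity_apply
  have h1 : HasDerivAt (fun y : ℝ => -(1 / 2) * y ^ 2) (-x) x := by
    have := (hasDerivAt_pow 2 x).const_mul (-(1 / 2) : ℝ)
    refine this.congr_deriv ?_
    norm_num
    ring
  rw [h]
  refine (h1.exp.const_mul _).congr_deriv ?_
  ring

theorem contDiff_stdNormalDensity : ContDiff ℝ ⊤ stdNormalDensity := by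
  rw [funext stdNormalDensity_apply]
  fun_prop

theorem hasDerivAt_iteratedDeriv_stdNormalDensity (m : ℕ) (x : ℝ) :
    HasDerivAt (iteratedDeriv m stdNormalDensity)
      (iteratedDeriv (m + 1) stdNormalDensity x) x := by
  rw [iteratedDeriv_succ]
  exact ((contDiff_stdNormalDensity.differentiable_iteratedDeriv m
    (WithTop.coe_lt_top _)) x).hasDerivAt

theorem continuous_iteratedDeriv_stdNormalDensity (m : ℕ) :
    Continuous (iteratedDeriv m stdNormalDensity) :=
  continuous_iff_continuousAt.2 fun x =>
    (hasDerivAt_iteratedDeriv_stdNormalDensity m x).continuousAt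

theorem iteratedDeriv_one_stdNormalDensity (x : ℝ) :
    iteratedDeriv 1 stdNormalDensity x = -(x * stdNormalDensity x) := by
  rw [iteratedDeriv_one, (hasDerivAt_stdNormalDensity x).deriv]

/-- The three-term recurrence of the Hermite functions. -/
theorem iteratedDeriv_add_two_stdNormalDensity (m : ℕ) (x : ℝ) :
    iteratedDeriv (m + 2) stdNormalDensity x =
      -(x * iteratedDeriv (m + 1) stdNormalDensity x)
        - (m + 1) * iteratedDeriv m stdNormalDensity x := by
  induction m generalizing x with
  | zero =>
    have h : iteratedDeriv (0 + 1) stdNormalDensity = fun y => -(y * stdNormalDensity y) :=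
      funext iteratedDeriv_one_stdNormalDensity
    rw [iteratedDeriv_succ (n := 0 + 1), h]
    refine (((hasDerivAt_id x).mul (hasDerivAt_stdNormalDensity x)).neg).deriv.trans ?_
    simp only [id, iteratedDeriv_zero, Nat.cast_zero]
    ring
  | succ m ih =>
    conv_lhs => rw [iteratedDeriv_succ (n := m + 1 + 1), funext ih]
    refine ((((hasDerivAt_id x).mul
      (hasDerivAt_iteratedDeriv_stdNormalDensity (m + 1) x)).neg).sub
      ((hasDerivAt_iteratedDeriv_stdNormalDensity m x).const_mul ((m : ℝ) + 1))).deriv.trans ?_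
    simp only [id]
    push_cast
    ring

theorem exists_iteratedDeriv_stdNormalDensity_eq (m : ℕ) :
    ∃ p : Polynomial ℝ, ∀ x, iteratedDeriv m stdNormalDensity x =
      p.eval x * stdNormalDensity x := by
  induction m using Nat.twoStepInduction with
  | zero => exact ⟨1, fun x => by simp⟩
  | one => exact ⟨-Polynomial.X, fun x => by simp [iteratedDeriv_one_stdNormalDensity]⟩
  | more m h0 h1 =>
    obtain ⟨p, hp⟩ := h0
    obtain ⟨q, hq⟩ := h1
    refine ⟨-(Polynomial.X * q) - Polynomial.C ((m : ℝ) + 1) * p, fun x => ?_⟩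
    rw [iteratedDeriv_add_two_stdNormalDensity, hp, hq]
    simp only [Polynomial.eval_sub, Polynomial.eval_neg, Polynomial.eval_mul, Polynomial.eval_X,
      Polynomial.eval_C]
    ring

theorem integrable_polynomial_mul_stdNormalDensity (p : Polynomial ℝ) :
    Integrable fun x => p.eval x * stdNormalDensity x := by
  have hpow (n : ℕ) : Integrable fun x : ℝ => x ^ n * stdNormalDensity x := by
    have h := (integrable_rpow_mul_exp_neg_mul_sq (b := 1 / 2) (by norm_num)
      (s := (n : ℝ)) (by linarith [n.cast_nonneg (α := ℝ)])).const_mul (Real.sqrt (2 * Real.pi))⁻¹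
    refine h.congr (ae_of_all _ fun x => ?_)
    simp only [stdNormalDensity_apply, Real.rpow_natCast]
    ring
  induction p using Polynomial.induction_on' with
  | add p q hp hq =>
    refine (hp.add hq).congr (ae_of_all _ fun x => ?_)
    simp only [Pi.add_apply, Polynomial.eval_add]
    ring
  | monomial n a =>
    refine ((hpow n).const_mul a).congr (ae_of_all _ fun x => ?_)
    simp only [Polynomial.eval_monomial]
    ring

theorem abs_stdNormalDensity_le (x : ℝ) : |stdNormalDensity x| ≤ (Real.sqrt (2 * Real.pi))⁻¹ := by
  rw [stdNormalDensity_apply, abs_mul, Real.abs_exp, abs_of_nonneg (by positivity)]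
  refine mul_le_of_le_one_right (by positivity) (Real.exp_le_one_iff.2 ?_)
  nlinarith [sq_nonneg x]

theorem integrable_iteratedDeriv_stdNormalDensity (m : ℕ) :
    Integrable (iteratedDeriv m stdNormalDensity) := by
  obtain ⟨p, hp⟩ := exists_iteratedDeriv_stdNormalDensity_eq m
  rw [funext hp]
  exact integrable_polynomial_mul_stdNormalDensity p

theorem integrable_iteratedDeriv_mul_iteratedDeriv_stdNormalDensity (k l : ℕ) :
    Integrable fun x =>
      iteratedDeriv k stdNormalDensity x * iteratedDeriv l stdNormalDensity x := by
  obtain ⟨p, hp⟩ := exists_iteratedDeriv_stdNormalDensity_eq k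
  obtain ⟨q, hq⟩ := exists_iteratedDeriv_stdNormalDensity_eq l
  have h := (integrable_polynomial_mul_stdNormalDensity (p * q)).mul_bdd
    (g := stdNormalDensity) (c := (Real.sqrt (2 * Real.pi))⁻¹)
    contDiff_stdNormalDensity.continuous.aestronglyMeasurable
    (ae_of_all _ abs_stdNormalDensity_le)
  refine h.congr (ae_of_all _ fun x => ?_)
  simp only [hp, hq, Polynomial.eval_mul]
  ring

theorem integral_iteratedDeriv_succ_mul (k l : ℕ) :
    ∫ x, iteratedDeriv (k + 1) stdNormalDensity x * iteratedDeriv l stdNormalDensity x =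
      -∫ x, iteratedDeriv k stdNormalDensity x * iteratedDeriv (l + 1) stdNormalDensity x := by
  rw [integral_mul_deriv_eq_deriv_mul_of_integrable
    (u := iteratedDeriv k stdNormalDensity) (v := iteratedDeriv l stdNormalDensity)
    (fun x _ => hasDerivAt_iteratedDeriv_stdNormalDensity k x)
    (fun x _ => hasDerivAt_iteratedDeriv_stdNormalDensity l x)
    (integrable_iteratedDeriv_mul_iteratedDeriv_stdNormalDensity k (l + 1))
    (integrable_iteratedDeriv_mul_iteratedDeriv_stdNormalDensity (k + 1) l)
    (integrable_iteratedDeriv_mul_iteratedDeriv_stdNormalDensity k l), neg_neg]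

theorem integral_iteratedDeriv_mul_iteratedDeriv (k l : ℕ) :
    ∫ x, iteratedDeriv k stdNormalDensity x * iteratedDeriv l stdNormalDensity x =
      (-1) ^ k * ∫ x, stdNormalDensity x * iteratedDeriv (k + l) stdNormalDensity x := by
  induction k generalizing l with
  | zero => simp
  | succ k ih =>
    rw [integral_iteratedDeriv_succ_mul, ih, show k + (l + 1) = k + 1 + l by ring]
    ring

theorem integral_stdNormalDensity_sq :
    ∫ x, stdNormalDensity x * stdNormalDensity x = 1 / (2 * Real.sqrt Real.pi) := by
  have h : (fun x => stdNormalDensity x * stdNormalDensity x) =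
      fun x => (2 * Real.pi)⁻¹ * Real.exp (-1 * x ^ 2) := by
    funext x
    rw [stdNormalDensity_apply, mul_mul_mul_comm, ← mul_inv, Real.mul_self_sqrt (by positivity),
      ← Real.exp_add]
    congr 2
    ring
  rw [h, integral_const_mul, integral_gaussian, div_one]
  have := Real.mul_self_sqrt Real.pi_pos.le
  have h0 : Real.sqrt Real.pi ≠ 0 := by positivity
  field_simp
  nlinarith

/-- Since `-xφ = φ'`, the Hermite recurrence produces `∫ φ' φ^{(m+1)}`, which by parts is minus the
original integral; hence the factor 2. -/
theorem integral_stdNormalDensity_mul_iteratedDeriv_add_two (m : ℕ) :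
    2 * ∫ x, stdNormalDensity x * iteratedDeriv (m + 2) stdNormalDensity x =
      -(m + 1) * ∫ x, stdNormalDensity x * iteratedDeriv m stdNormalDensity x := by
  have i (l : ℕ) : Integrable fun x => stdNormalDensity x * iteratedDeriv l stdNormalDensity x := by
    simpa using integrable_iteratedDeriv_mul_iteratedDeriv_stdNormalDensity 0 l
  have h : ∫ x, iteratedDeriv 1 stdNormalDensity x * iteratedDeriv (m + 1) stdNormalDensity x =
      -∫ x, stdNormalDensity x * iteratedDeriv (m + 2) stdNormalDensity x := by
    simpa using integral_iteratedDeriv_succ_mul 0 (m + 1)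
  have e : ∫ x, stdNormalDensity x * iteratedDeriv (m + 2) stdNormalDensity x =
      ∫ x, (iteratedDeriv 1 stdNormalDensity x * iteratedDeriv (m + 1) stdNormalDensity x -
        (m + 1) * (stdNormalDensity x * iteratedDeriv m stdNormalDensity x)) := by
    congr 1
    funext x
    rw [iteratedDeriv_add_two_stdNormalDensity, iteratedDeriv_one_stdNormalDensity]
    ring
  rw [integral_sub (integrable_iteratedDeriv_mul_iteratedDeriv_stdNormalDensity _ _)
    ((i m).const_mul _), integral_const_mul, h] at e
  linarith

theorem integral_stdNormalDensity_mul_iteratedDeriv (m : ℕ) :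
    ∫ x, stdNormalDensity x * iteratedDeriv (2 * m) stdNormalDensity x =
      (-1) ^ m * (2 * m).factorial / (4 ^ m * m.factorial) / (2 * Real.sqrt Real.pi) := by
  induction m with
  | zero => simpa using integral_stdNormalDensity_sq
  | succ m ih =>
    have h := integral_stdNormalDensity_mul_iteratedDeriv_add_two (2 * m)
    rw [ih] at h
    rw [show 2 * (m + 1) = 2 * m + 2 by ring, ← mul_right_inj' (two_ne_zero' ℝ), h,
      Nat.factorial_succ (2 * m + 1), Nat.factorial_succ (2 * m), Nat.factorial_succ m]
    have h0 : Real.sqrt Real.pi ≠ 0 := by positivity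
    push_cast
    field_simp
    ring

/-! ### Reduction of `C(n+1)` to a finite sum. -/

/-- The coefficient of `φ^{(2s)}` in the Gaussian-based kernels. -/
noncomputable def gaussianKernelCoeff (s : ℕ) : ℝ := (-1) ^ s / (2 ^ s * s.factorial)

/-- The Hermite recurrence makes the sum telescope, because the coefficients satisfy `c_n = -2(n+1)
c_{n+1}`. -/
theorem mul_gaussianKernel_succ (n : ℕ) (x : ℝ) :
    x * gaussianKernel (n + 1) x =
      -(gaussianKernelCoeff n * iteratedDeriv (2 * n + 1) stdNormalDensity x) := by
  unfold gaussianKernel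
  induction n with
  | zero => simp [gaussianKernelCoeff, iteratedDeriv_one_stdNormalDensity]
  | succ n ih =>
    rw [Finset.sum_range_succ, mul_add, ih, show 2 * (n + 1) + 1 = 2 * n + 1 + 2 by ring,
      iteratedDeriv_add_two_stdNormalDensity (2 * n + 1), show 2 * (n + 1) = 2 * n + 1 + 1 by ring]
    unfold gaussianKernelCoeff
    rw [Nat.factorial_succ]
    push_cast
    field_simp
    ring

theorem integrable_gaussianKernel (r : ℕ) : Integrable (gaussianKernel r) :=
  integrable_finsetSum _ fun s _ =>
    (integrable_iteratedDeriv_stdNormalDensity (2 * s)).const_mul _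

theorem continuous_gaussianKernel (r : ℕ) : Continuous (gaussianKernel r) :=
  continuous_finsetSum _ fun s _ =>
    continuous_const.mul (continuous_iteratedDeriv_stdNormalDensity (2 * s))

theorem hasDerivAt_integratedKernel {k : ℝ → ℝ} (hk : Integrable k) (hc : Continuous k) (x : ℝ) :
    HasDerivAt (integratedKernel k) (k x) x := by
  have h : integratedKernel k = fun y => integratedKernel k 0 + ∫ z in (0 : ℝ)..y, k z := by
    funext y
    rw [← intervalIntegral.integral_Iic_sub_Iic hk.integrableOn hk.integrableOn]
    simp [integratedKernel]
  rw [h]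
  exact (intervalIntegral.integral_hasDerivAt_right (hc.intervalIntegrable _ _)
    (hc.stronglyMeasurableAtFilter _ _) hc.continuousAt).const_add _

theorem norm_integratedKernel_le {k : ℝ → ℝ} (hk : Integrable k) (x : ℝ) :
    ‖integratedKernel k x‖ ≤ ∫ z, ‖k z‖ :=
  (norm_integral_le_integral_norm _).trans
    (setIntegral_le_integral hk.norm (ae_of_all _ fun _ => norm_nonneg _))

theorem psiOne_gaussianKernel_succ (n : ℕ) :
    psiOne (gaussianKernel (n + 1)) =
      2 * ∑ s ∈ Finset.range (n + 1), gaussianKernelCoeff s * gaussianKernelCoeff n *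
        ∫ x, iteratedDeriv (2 * s) stdNormalDensity x *
          iteratedDeriv (2 * n) stdNormalDensity x := by
  set g := gaussianKernel (n + 1) with hg
  have ig : Integrable g := integrable_gaussianKernel _
  have hG := hasDerivAt_integratedKernel ig (continuous_gaussianKernel _)
  have cG : Continuous (integratedKernel g) :=
    continuous_iff_continuousAt.2 fun x => (hG x).continuousAt
  have bG (m : ℕ) : Integrable (integratedKernel g * iteratedDeriv m stdNormalDensity) :=
    (integrable_iteratedDeriv_stdNormalDensity m).bdd_mul cG.aestronglyMeasurable
      (ae_of_all _ (norm_integratedKernel_le ig))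
  have is (s : ℕ) : Integrable fun x => gaussianKernelCoeff s *
      (iteratedDeriv (2 * s) stdNormalDensity x * iteratedDeriv (2 * n) stdNormalDensity x) :=
    (integrable_iteratedDeriv_mul_iteratedDeriv_stdNormalDensity _ _).const_mul _
  have eg : g * iteratedDeriv (2 * n) stdNormalDensity =
      fun x => ∑ s ∈ Finset.range (n + 1), gaussianKernelCoeff s *
        (iteratedDeriv (2 * s) stdNormalDensity x * iteratedDeriv (2 * n) stdNormalDensity x) := by
    funext x
    simp only [Pi.mul_apply, hg, gaussianKernel, Finset.sum_mul, gaussianKernelCoeff, mul_assoc]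
  -- The primitive is bounded, so its products with derivatives of `φ` are integrable and no
  -- boundary term survives.
  have parts := integral_mul_deriv_eq_deriv_mul_of_integrable (u := integratedKernel g)
    (v := iteratedDeriv (2 * n) stdNormalDensity) (fun x _ => hG x)
    (fun x _ => hasDerivAt_iteratedDeriv_stdNormalDensity (2 * n) x) (bG _)
    (by rw [eg]; exact integrable_finsetSum _ fun s _ => is s) (bG _)
  have e : ∫ x, x * integratedKernel g x * g x =
      -gaussianKernelCoeff n *
        ∫ x, integratedKernel g x * iteratedDeriv (2 * n + 1) stdNormalDensity x := by
    rw [← integral_const_mul]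
    congr 1
    funext x
    rw [mul_right_comm, hg, mul_gaussianKernel_succ]
    ring
  have eg' : ∫ x, g x * iteratedDeriv (2 * n) stdNormalDensity x =
      ∑ s ∈ Finset.range (n + 1), gaussianKernelCoeff s *
        ∫ x, iteratedDeriv (2 * s) stdNormalDensity x *
          iteratedDeriv (2 * n) stdNormalDensity x := by
    simp only [← integral_const_mul]
    rw [← integral_finsetSum _ fun s _ => is s]
    exact congrArg (fun f => ∫ x, f x) eg
  rw [psiOne, e, parts, eg', neg_mul_neg, Finset.mul_sum]
  congr 1
  refine Finset.sum_congr rfl fun s _ => ?_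
  ring

/-- The `s`-th summand in the finite sum for `C(n + 1)`. -/
noncomputable def kernelConstTerm (s n : ℕ) : ℝ :=
  (2 * (s + n)).factorial / (8 ^ (s + n) * (s + n).factorial * s.factorial * n.factorial)

theorem kernelConst_succ_eq_sum (n : ℕ) :
    kernelConst (n + 1) = ∑ s ∈ Finset.range (n + 1), kernelConstTerm s n := by
  rw [kernelConst, psiOne_gaussianKernel_succ, Finset.mul_sum, Finset.mul_sum]
  refine Finset.sum_congr rfl fun s _ => ?_
  rw [integral_iteratedDeriv_mul_iteratedDeriv, ← mul_add,
    integral_stdNormalDensity_mul_iteratedDeriv]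
  have h0 : Real.sqrt Real.pi ≠ 0 := by positivity
  have h1 : (-1 : ℝ) ^ (2 * s) = 1 := by simp
  have h2 : (-1 : ℝ) ^ s * (-1) ^ n * (-1) ^ (s + n) = 1 := by
    rw [← pow_add, ← mul_pow]; simp
  have h8 : (8 : ℝ) ^ (s + n) = 2 ^ s * 2 ^ n * 4 ^ (s + n) := by
    rw [← pow_add, ← mul_pow]; norm_num
  unfold gaussianKernelCoeff kernelConstTerm
  rw [h1, h8]
  calc _ = ((-1 : ℝ) ^ s * (-1) ^ n * (-1) ^ (s + n)) * ((2 * (s + n)).factorial /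
      (2 ^ s * 2 ^ n * 4 ^ (s + n) * (s + n).factorial * s.factorial * n.factorial)) := by
        field_simp
    _ = _ := by rw [h2, one_mul]

/-! ### The recurrence for `C`. -/

theorem kernelConstTerm_succ_right (s n : ℕ) :
    kernelConstTerm s (n + 1) = kernelConstTerm s n * (n + s + 1 / 2) / (2 * (n + 1)) := by
  unfold kernelConstTerm
  rw [← add_assoc, show 2 * (s + n + 1) = 2 * (s + n) + 1 + 1 by ring, Nat.factorial_succ (_ + 1),
    Nat.factorial_succ (2 * _), Nat.factorial_succ (s + n), Nat.factorial_succ n]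
  push_cast
  field_simp
  ring

theorem kernelConstTerm_comm (s n : ℕ) : kernelConstTerm s n = kernelConstTerm n s := by
  unfold kernelConstTerm
  rw [add_comm]
  ring

theorem kernelConstTerm_succ_left (s n : ℕ) :
    kernelConstTerm (s + 1) n = kernelConstTerm s n * (n + s + 1 / 2) / (2 * (s + 1)) := by
  rw [kernelConstTerm_comm, kernelConstTerm_succ_right, kernelConstTerm_comm]
  ring

/-- Creative telescoping: the summand is a difference in `s` with rational certificate `-s/(n+1)`.
-/
theorem kernelConstTerm_telescope (n N : ℕ) :
    ∑ s ∈ Finset.range N,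
      (kernelConstTerm s (n + 1) - (2 * n + 1) / (2 * n + 2) * kernelConstTerm s n) =
        -(N / (n + 1) * kernelConstTerm N n) := by
  induction N with
  | zero => simp
  | succ N ih =>
    rw [Finset.sum_range_succ, ih, kernelConstTerm_succ_right, kernelConstTerm_succ_left]
    push_cast
    field_simp
    ring

theorem kernelConst_recurrence (n : ℕ) :
    kernelConst (n + 2) = (2 * n + 1) / (2 * n + 2) * kernelConst (n + 1) -
      kernelConstTerm (n + 1) n / (4 * (n + 1)) := by
  have h := kernelConstTerm_telescope n (n + 1)
  rw [Finset.sum_sub_distrib, ← Finset.mul_sum, ← kernelConst_succ_eq_sum] at h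
  -- The sum for `n + 2` has one term more than the telescoped range; it nearly cancels the boundary
  -- term at `N = n + 1`.
  rw [kernelConst_succ_eq_sum, Finset.sum_range_succ, kernelConstTerm_succ_right (n + 1) n]
  rw [sub_eq_iff_eq_add] at h
  rw [h]
  push_cast
  field_simp
  ring

/-! ### Central binomial coefficients and the product form of `C`. -/

/-- The normalized central binomial coefficient `4⁻ⁿ (2n choose n)`. -/
noncomputable def normCentralBinom (n : ℕ) : ℝ := n.centralBinom / 4 ^ n

theorem normCentralBinom_pos (n : ℕ) : 0 < normCentralBinom n :=
  div_pos (Nat.cast_pos.2 n.centralBinom_pos) (by positivity)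

theorem normCentralBinom_zero : normCentralBinom 0 = 1 := by simp [normCentralBinom]

theorem normCentralBinom_succ (n : ℕ) :
    normCentralBinom (n + 1) = (2 * n + 1) / (2 * n + 2) * normCentralBinom n := by
  have h : ((n : ℝ) + 1) * (n + 1).centralBinom = 2 * (2 * n + 1) * n.centralBinom := by
    exact_mod_cast Nat.succ_mul_centralBinom_succ n
  unfold normCentralBinom
  field_simp
  rw [pow_succ]
  linear_combination 2 * 4 ^ n * h

theorem normCentralBinom_eq_factorial (n : ℕ) :
    normCentralBinom n = (2 * n).factorial / (4 ^ n * (n.factorial : ℝ) ^ 2) := by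
  unfold normCentralBinom
  rw [Nat.centralBinom_eq_two_mul_choose, Nat.cast_choose ℝ (by lia), show 2 * n - n = n by lia]
  field_simp

/-- Up to sign, the coefficient of `x ^ (n + 1)` in the binomial series of `√(1 - x)`. -/
noncomputable def sqrtCoeff (n : ℕ) : ℝ := normCentralBinom n - normCentralBinom (n + 1)

theorem sqrtCoeff_eq (n : ℕ) : sqrtCoeff n = normCentralBinom n / (2 * n + 2) := by
  rw [sqrtCoeff, normCentralBinom_succ]
  field_simp
  ring

theorem sqrtCoeff_eq_catalan (n : ℕ) : sqrtCoeff n = catalan n / (2 * 4 ^ n) := by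
  have h : ((n : ℝ) + 1) * catalan n = n.centralBinom := by
    exact_mod_cast succ_mul_catalan_eq_centralBinom n
  rw [sqrtCoeff_eq, normCentralBinom, ← h]
  field_simp

theorem sqrtCoeff_nonneg (n : ℕ) : 0 ≤ sqrtCoeff n := by
  rw [sqrtCoeff_eq]
  have := (normCentralBinom_pos n).le
  positivity

theorem normCentralBinom_antitone : Antitone normCentralBinom :=
  antitone_nat_of_succ_le fun n => sub_nonneg.1 (sqrtCoeff_nonneg n)

theorem sqrtCoeff_antitone : Antitone sqrtCoeff := by
  refine antitone_nat_of_succ_le fun n => ?_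
  rw [sqrtCoeff_eq, sqrtCoeff_eq]
  refine div_le_div₀ (normCentralBinom_pos n).le (normCentralBinom_antitone n.le_succ)
    (by positivity) ?_
  push_cast
  linarith

/-- The factor `normCentralBinom (n + 1)` is what turns the recurrence, divided by it, into a plain
partial sum. -/
theorem kernelConstTerm_succ_self (n : ℕ) :
    kernelConstTerm (n + 1) n / (4 * (n + 1)) =
      normCentralBinom (n + 1) * sqrtCoeff (2 * n + 1) := by
  rw [sqrtCoeff_eq, normCentralBinom_eq_factorial, normCentralBinom_eq_factorial, kernelConstTerm,
    show n + 1 + n = 2 * n + 1 by ring, show 2 * (n + 1) = 2 * n + 1 + 1 by ring,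
    Nat.factorial_succ (2 * n + 1), Nat.factorial_succ n,
    show (8 : ℝ) ^ (2 * n + 1) = 4 ^ (2 * n + 1) * (2 * 4 ^ n) by
      rw [show (8 : ℝ) = 4 * 2 by norm_num, mul_pow, pow_succ 2, pow_mul 2]; norm_num; ring]
  push_cast
  field_simp
  ring

theorem kernelConst_succ_eq_mul (n : ℕ) :
    kernelConst (n + 1) =
      normCentralBinom n * (1 - ∑ i ∈ Finset.range n, sqrtCoeff (2 * i + 1)) := by
  induction n with
  | zero => simp [kernelConst_succ_eq_sum, kernelConstTerm, normCentralBinom_zero]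
  | succ n ih =>
    rw [kernelConst_recurrence, ih, kernelConstTerm_succ_self, Finset.sum_range_succ,
      normCentralBinom_succ]
    ring

/-! ### Wallis bounds for the central binomial coefficients. -/

theorem normCentralBinom_sq_mul (n : ℕ) :
    normCentralBinom n ^ 2 * (2 * n + 1) * Real.Wallis.W n = 1 := by
  rw [Real.Wallis.W_eq_factorial_ratio, normCentralBinom_eq_factorial,
    show (2 : ℝ) ^ (4 * n) = (4 ^ n) ^ 2 by rw [← pow_mul, pow_mul, mul_comm n, pow_mul]; norm_num]
  field_simp

theorem le_normCentralBinom_sq (n : ℕ) :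
    1 / (Real.pi * (n + 1 / 2)) ≤ normCentralBinom n ^ 2 := by
  have h := normCentralBinom_sq_mul n
  have hW := Real.Wallis.W_le n
  rw [div_le_iff₀ (by positivity)]
  have : 0 ≤ normCentralBinom n ^ 2 * (2 * n + 1) := by positivity
  nlinarith [mul_le_mul_of_nonneg_left hW this]

theorem normCentralBinom_sq_le {n : ℕ} (hn : 0 < n) :
    normCentralBinom n ^ 2 ≤ 1 / (Real.pi * n) := by
  have h := normCentralBinom_sq_mul n
  have hn' : (0 : ℝ) < n := Nat.cast_pos.2 hn
  have hW := Real.Wallis.le_W n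
  have h1 : (n : ℝ) / (2 * n + 1) ≤ (2 * n + 1) / (2 * n + 2) / 2 := by
    rw [div_div, div_le_div_iff₀ (by positivity) (by positivity)]
    nlinarith
  have h2 : n / (2 * n + 1) * Real.pi ≤ Real.Wallis.W n := by
    nlinarith [mul_le_mul_of_nonneg_right h1 Real.pi_pos.le]
  rw [le_div_iff₀ (by positivity)]
  calc normCentralBinom n ^ 2 * (Real.pi * n)
      = normCentralBinom n ^ 2 * (2 * n + 1) * (n / (2 * n + 1) * Real.pi) := by field_simp
    _ ≤ normCentralBinom n ^ 2 * (2 * n + 1) * Real.Wallis.W n := by gcongr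
    _ = 1 := h

theorem tendsto_normCentralBinom : Tendsto normCentralBinom atTop (nhds 0) := by
  have h : Tendsto (fun n => normCentralBinom n ^ 2) atTop (nhds 0) := by
    refine squeeze_zero' (Eventually.of_forall fun n => sq_nonneg _)
      ((eventually_gt_atTop 0).mono fun n hn => normCentralBinom_sq_le hn) ?_
    exact tendsto_const_nhds.div_atTop
      (tendsto_natCast_atTop_atTop.const_mul_atTop Real.pi_pos)
  have h' := h.sqrt
  simpa [Real.sqrt_sq (normCentralBinom_pos _).le] using h'

/-! ### The series of `√(1-x)` at `x = ±1`. -/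

theorem hasSum_sqrtCoeff : HasSum sqrtCoeff 1 := by
  rw [hasSum_iff_tendsto_nat_of_nonneg sqrtCoeff_nonneg]
  have h (n : ℕ) : ∑ i ∈ Finset.range n, sqrtCoeff i = 1 - normCentralBinom n := by
    rw [← normCentralBinom_zero]
    exact Finset.sum_range_sub' _ _
  simpa [h] using tendsto_normCentralBinom.const_sub 1

/-- This is the Catalan convolution, rescaled. -/
theorem sqrtCoeff_convolution (n : ℕ) :
    ∑ ij ∈ Finset.HasAntidiagonal.antidiagonal n, sqrtCoeff ij.1 * sqrtCoeff ij.2 = 2 * sqrtCoeff (n + 1) := by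
  simp only [sqrtCoeff_eq_catalan]
  rw [catalan_succ', Nat.cast_sum, Finset.sum_div, Finset.mul_sum]
  refine Finset.sum_congr rfl fun ij hij => ?_
  rw [pow_succ, ← Finset.HasAntidiagonal.mem_antidiagonal.1 hij, pow_add]
  push_cast
  field_simp
  ring

theorem tsum_alternating_sqrtCoeff : ∑' n, (-1) ^ n * sqrtCoeff n = Real.sqrt 2 - 1 := by
  set f : ℕ → ℝ := fun n => (-1) ^ n * sqrtCoeff n with hf
  have hn : (fun n => ‖f n‖) = sqrtCoeff := by
    funext n
    simp [hf, abs_of_nonneg (sqrtCoeff_nonneg n)]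
  have sn : Summable fun n => ‖f n‖ := hn ▸ hasSum_sqrtCoeff.summable
  have hle : |∑' n, f n| ≤ 1 := by
    have := norm_tsum_le_tsum_norm sn
    rwa [hn, hasSum_sqrtCoeff.tsum_eq] at this
  have hconv (n : ℕ) : ∑ ij ∈ Finset.HasAntidiagonal.antidiagonal n, f ij.1 * f ij.2 = -2 * f (n + 1) := by
    have : ∑ ij ∈ Finset.HasAntidiagonal.antidiagonal n, f ij.1 * f ij.2 =
        (-1) ^ n * ∑ ij ∈ Finset.HasAntidiagonal.antidiagonal n, sqrtCoeff ij.1 * sqrtCoeff ij.2 := by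
      rw [Finset.mul_sum]
      refine Finset.sum_congr rfl fun ij hij => ?_
      rw [← Finset.HasAntidiagonal.mem_antidiagonal.1 hij, pow_add]
      ring
    rw [this, sqrtCoeff_convolution, hf]
    ring
  have hsq := tsum_mul_tsum_eq_tsum_sum_antidiagonal_of_summable_norm sn sn
  simp only [hconv] at hsq
  rw [tsum_mul_left] at hsq
  have h0 := sn.of_norm.tsum_eq_zero_add
  have hf0 : f 0 = 1 / 2 := by simp [hf, sqrtCoeff_eq, normCentralBinom_zero]
  rw [hf0] at h0
  -- With `S = ∑' n, f n`, the Cauchy square gives `S² = -2(S - 1/2)`; the bound `|S| ≤ 1` then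
  -- selects the positive root.
  have h2 : (∑' n, f n + 1) ^ 2 = 2 := by nlinarith
  rw [← h2, Real.sqrt_sq (by linarith [neg_le_of_abs_le hle])]
  ring

theorem hasSum_sqrtCoeff_odd :
    HasSum (fun i => sqrtCoeff (2 * i + 1)) (1 - Real.sqrt 2 / 2) := by
  have hs := hasSum_sqrtCoeff.summable
  have he : Summable fun i => sqrtCoeff (2 * i) :=
    hs.comp_injective (mul_right_injective₀ (two_ne_zero' ℕ))
  have ho : Summable fun i => sqrtCoeff (2 * i + 1) :=
    hs.comp_injective (i := fun i => 2 * i + 1) fun a b h => by simpa using h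
  have h1 := (he.hasSum.even_add_odd ho.hasSum).unique hasSum_sqrtCoeff
  have h2 := tsum_alternating_sqrtCoeff
  have h3 := HasSum.even_add_odd (f := fun n => (-1) ^ n * sqrtCoeff n)
    (by simpa [pow_mul] using he.hasSum) (by simpa [pow_add, pow_mul] using ho.hasSum.neg)
  rw [h3.tsum_eq] at h2
  convert! ho.hasSum using 1
  linarith

/-! ### The tail of the odd series. -/

/-- The tail `∑_{i ≥ n}` of the odd-indexed coefficients, shifted to start at `i = n`. -/
noncomputable def oddTail (n : ℕ) : ℝ :=
  1 - Real.sqrt 2 / 2 - ∑ i ∈ Finset.range n, sqrtCoeff (2 * i + 1)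

theorem kernelConst_succ_eq_oddTail (n : ℕ) :
    kernelConst (n + 1) = normCentralBinom n * (Real.sqrt 2 / 2 + oddTail n) := by
  rw [kernelConst_succ_eq_mul, oddTail]
  ring

theorem oddTail_succ (n : ℕ) : oddTail (n + 1) = oddTail n - sqrtCoeff (2 * n + 1) := by
  rw [oddTail, Finset.sum_range_succ, oddTail]
  ring

theorem tendsto_oddTail : Tendsto oddTail atTop (nhds 0) := by
  have := hasSum_sqrtCoeff_odd.tendsto_sum_nat.const_sub (1 - Real.sqrt 2 / 2)
  rwa [sub_self] at this

/-- Each `a_{2i+1}` is at most the mean of `a_{2i}` and `a_{2i+1}`, and these means telescope. For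
the lower bound `a_{2i+1}` is paired with `a_{2i+2}`. -/
theorem oddTail_le (n : ℕ) : oddTail n ≤ normCentralBinom (2 * n) / 2 := by
  have hm : Monotone fun n => oddTail n - normCentralBinom (2 * n) / 2 := by
    refine monotone_nat_of_le_succ fun n => ?_
    have h := sqrtCoeff_antitone (2 * n).le_succ
    have h' := h
    simp only [sqrtCoeff, Nat.succ_eq_add_one] at h'
    rw [oddTail_succ, mul_add_one, sqrtCoeff]
    linarith
  have ht : Tendsto (fun n => oddTail n - normCentralBinom (2 * n) / 2) atTop (nhds 0) := by
    have := tendsto_oddTail.sub ((tendsto_normCentralBinom.comp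
      (tendsto_id.const_mul_atTop' two_pos)).div_const 2)
    simpa using this
  linarith [hm.ge_of_tendsto ht n]

theorem le_oddTail (n : ℕ) : normCentralBinom (2 * n + 1) / 2 ≤ oddTail n := by
  have hm : Antitone fun n => oddTail n - normCentralBinom (2 * n + 1) / 2 := by
    refine antitone_nat_of_succ_le fun n => ?_
    have h := sqrtCoeff_antitone (2 * n + 1).le_succ
    have h' := h
    simp only [sqrtCoeff, Nat.succ_eq_add_one] at h'
    rw [oddTail_succ, mul_add_one, sqrtCoeff]
    linarith
  have ht : Tendsto (fun n => oddTail n - normCentralBinom (2 * n + 1) / 2) atTop (nhds 0) := by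
    have := tendsto_oddTail.sub ((tendsto_normCentralBinom.comp
      ((tendsto_add_atTop_nat 1).comp (tendsto_id.const_mul_atTop' two_pos))).div_const 2)
    simpa [Function.comp_def] using this
  linarith [hm.le_of_tendsto ht n]

/-! ### Explicit error bounds. -/

/-- Linearization `(1+t)^{-1/2} ≥ 1 - t/2` at `t = δ/m`, from `(1 - t/2)²(1+t) = 1 - t²(3-t)/4`. -/
theorem le_of_one_div_le_sq {m δ c : ℝ} (hm : 0 < m) (h0 : 0 ≤ δ) (hδ : δ ≤ m) (hc : 0 ≤ c)
    (h : 1 / (Real.pi * (m + δ)) ≤ c ^ 2) :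
    (Real.sqrt (Real.pi * m))⁻¹ * (1 - δ / (2 * m)) ≤ c := by
  refine (le_abs_self _).trans (abs_le_of_sq_le_sq (le_trans ?_ h) hc)
  rw [mul_pow, inv_pow, Real.sq_sqrt (by positivity), le_div_iff₀ (by positivity)]
  have hπ := Real.pi_pos
  have : (Real.pi * m)⁻¹ * (1 - δ / (2 * m)) ^ 2 * (Real.pi * (m + δ)) =
      1 - (δ / m) ^ 2 * (3 - δ / m) / 4 := by
    field_simp
    ring
  rw [this]
  have h1 : δ / m ≤ 1 := (div_le_one hm).2 hδ
  have : 0 ≤ (δ / m) ^ 2 * (3 - δ / m) := mul_nonneg (sq_nonneg _) (by linarith)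
  linarith

theorem normCentralBinom_le {n : ℕ} (hn : 0 < n) :
    normCentralBinom n ≤ (Real.sqrt (Real.pi * n))⁻¹ := by
  have h := Real.sqrt_le_sqrt (normCentralBinom_sq_le hn)
  rwa [Real.sqrt_sq (normCentralBinom_pos n).le, one_div, Real.sqrt_inv] at h

theorem inv_sqrt_pi_mul_two_mul (x : ℝ) :
    (Real.sqrt (Real.pi * (2 * x)))⁻¹ = Real.sqrt 2 / 2 * (Real.sqrt (Real.pi * x))⁻¹ := by
  rw [mul_left_comm, Real.sqrt_mul two_pos.le, mul_inv, Real.sqrt_div_self', one_div]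

theorem oddTail_le_inv_sqrt {n : ℕ} (hn : 0 < n) :
    oddTail n ≤ Real.sqrt 2 / 4 * (Real.sqrt (Real.pi * n))⁻¹ := by
  have h := normCentralBinom_le (n := 2 * n) (by lia)
  push_cast at h
  rw [inv_sqrt_pi_mul_two_mul] at h
  linarith [oddTail_le n]

theorem inv_sqrt_le_normCentralBinom {n : ℕ} (hn : 0 < n) :
    (Real.sqrt (Real.pi * n))⁻¹ * (1 - 1 / (4 * n)) ≤ normCentralBinom n := by
  have hn' : (1 : ℝ) ≤ n := Nat.one_le_cast.2 hn
  have := le_of_one_div_le_sq (by linarith) (by norm_num) (by linarith)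
    (normCentralBinom_pos n).le (le_normCentralBinom_sq n)
  convert! this using 3
  field_simp
  norm_num

theorem inv_sqrt_le_oddTail {n : ℕ} (hn : 0 < n) :
    Real.sqrt 2 / 4 * (Real.sqrt (Real.pi * n))⁻¹ * (1 - 3 / (8 * n)) ≤ oddTail n := by
  have hn' : (1 : ℝ) ≤ n := Nat.one_le_cast.2 hn
  have h := le_normCentralBinom_sq (2 * n + 1)
  push_cast at h
  rw [show (2 * n + 1 + 1 / 2 : ℝ) = 2 * n + 3 / 2 by ring] at h
  have := le_of_one_div_le_sq (by linarith) (by norm_num) (by linarith)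
    (normCentralBinom_pos _).le h
  rw [inv_sqrt_pi_mul_two_mul, show (3 / 2 : ℝ) / (2 * (2 * n)) = 3 / (8 * n) by
    field_simp; norm_num] at this
  linarith [le_oddTail n]

theorem abs_kernelConst_sub_le {n : ℕ} (hn : 0 < n) :
    |kernelConst (n + 1) - (Real.sqrt 2 / 2 * (Real.sqrt (Real.pi * n))⁻¹ +
      Real.sqrt 2 / 4 * (Real.pi * n)⁻¹)| ≤ (Real.sqrt (Real.pi * n))⁻¹ / n := by
  have hn' : (1 : ℝ) ≤ n := Nat.one_le_cast.2 hn
  set q := (Real.sqrt (Real.pi * n))⁻¹ with hq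
  have hq0 : 0 < q := by positivity
  have hq2 : (Real.pi * n)⁻¹ = q ^ 2 := by rw [hq, inv_pow, Real.sq_sqrt (by positivity)]
  have hq1 : q ≤ 1 := by
    refine inv_le_one_of_one_le₀ (Real.one_le_sqrt.2 ?_)
    nlinarith [Real.pi_gt_three]
  set e : ℝ := 1 / (8 * n) with he
  have he0 : 0 < e := by positivity
  have he1 : e ≤ 1 / 8 := by
    rw [he]
    exact one_div_le_one_div_of_le (by norm_num) (by linarith)
  have c1 := normCentralBinom_le hn
  have c2 := inv_sqrt_le_normCentralBinom hn
  have t1 := oddTail_le_inv_sqrt hn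
  have t2 := inv_sqrt_le_oddTail hn
  rw [show 1 / (4 * n : ℝ) = 2 * e by rw [he]; field_simp; norm_num] at c2
  rw [show 3 / (8 * n : ℝ) = 3 * e by rw [he]; field_simp] at t2
  rw [show q / n = 8 * e * q by rw [he]; field_simp, hq2, kernelConst_succ_eq_oddTail]
  have s0 : 0 < Real.sqrt 2 := by positivity
  have s2 : Real.sqrt 2 ≤ 2 := Real.sqrt_le_iff.2 (by norm_num)
  have up : normCentralBinom n * (Real.sqrt 2 / 2 + oddTail n) ≤
      q * (Real.sqrt 2 / 2 + Real.sqrt 2 / 4 * q) :=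
    mul_le_mul c1 (by linarith) (by
      have := (le_oddTail n)
      have := normCentralBinom_pos (2 * n + 1)
      linarith) hq0.le
  have lo : q * (1 - 2 * e) * (Real.sqrt 2 / 2 + Real.sqrt 2 / 4 * q * (1 - 3 * e)) ≤
      normCentralBinom n * (Real.sqrt 2 / 2 + oddTail n) := by
    refine mul_le_mul c2 (by linarith) ?_ (normCentralBinom_pos n).le
    have : 0 ≤ 1 - 3 * e := by linarith
    positivity
  have key : q * (1 - 2 * e) * (Real.sqrt 2 / 2 + Real.sqrt 2 / 4 * q * (1 - 3 * e)) -
      (Real.sqrt 2 / 2 * q + Real.sqrt 2 / 4 * q ^ 2) =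
      -(e * q) * (Real.sqrt 2 * (1 + q * (5 / 4 - 3 / 2 * e))) := by ring
  -- The upper bound `up` is exactly the main term; the lower one loses at most `6eq`, within the
  -- allowed `8eq = q/n`.
  have hb : Real.sqrt 2 * (1 + q * (5 / 4 - 3 / 2 * e)) ≤ 2 * 3 := by
    refine mul_le_mul s2 ?_ ?_ (by norm_num)
    · nlinarith
    · nlinarith
  have heq : 0 < e * q := mul_pos he0 hq0
  rw [abs_le]
  constructor <;> nlinarith

theorem abs_kernelConst_sub_asymptotic_le {n : ℕ} (hn : 0 < n) :
    |kernelConst (n + 1) - (Real.pi ^ (-(1 / 2) : ℝ) * (2 * (n : ℝ)) ^ (-(1 / 2) : ℝ) +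
      Real.sqrt 2 * Real.pi⁻¹ * (4 * (n : ℝ) + 1)⁻¹)| ≤ 8 * ((n : ℝ) + 1) ^ (-(3 / 2) : ℝ) := by
  have hn' : (1 : ℝ) ≤ n := Nat.one_le_cast.2 hn
  have hπ := Real.pi_gt_three
  set w : ℝ := (n : ℝ) ^ (-(3 / 2) : ℝ) with hw
  have hw' : w = (n * Real.sqrt n)⁻¹ := by
    rw [hw, Real.rpow_neg (by linarith), show (3 / 2 : ℝ) = 1 + 1 / 2 by norm_num,
      Real.rpow_add (by linarith), Real.rpow_one, ← Real.sqrt_eq_rpow]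
  have sn : Real.sqrt n ≤ n := Real.sqrt_le_iff.2 ⟨by linarith, by nlinarith⟩
  have e1 : Real.pi ^ (-(1 / 2) : ℝ) * (2 * (n : ℝ)) ^ (-(1 / 2) : ℝ) =
      Real.sqrt 2 / 2 * (Real.sqrt (Real.pi * n))⁻¹ := by
    rw [← Real.mul_rpow Real.pi_pos.le (by linarith), Real.rpow_neg (by positivity),
      ← Real.sqrt_eq_rpow, inv_sqrt_pi_mul_two_mul]
  have e2 : |Real.sqrt 2 / 4 * (Real.pi * n)⁻¹ - Real.sqrt 2 * Real.pi⁻¹ * (4 * (n : ℝ) + 1)⁻¹| ≤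
      w := by
    have s2 : Real.sqrt 2 ≤ 2 := Real.sqrt_le_iff.2 (by norm_num)
    have : Real.sqrt 2 / 4 * (Real.pi * n)⁻¹ - Real.sqrt 2 * Real.pi⁻¹ * (4 * (n : ℝ) + 1)⁻¹ =
        Real.sqrt 2 / (Real.pi * (4 * n * (4 * n + 1))) := by
      field_simp
      ring
    rw [this, abs_of_nonneg (by positivity), hw', ← one_div]
    refine div_le_div₀ zero_le_one ?_ (by positivity) ?_ |>.trans' ?_ (b := 1 / (n * n : ℝ))
    · exact le_rfl
    · gcongr
    · rw [div_le_div_iff₀ (by positivity) (by positivity)]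
      nlinarith [mul_nonneg (sub_nonneg.2 hπ.le) (mul_self_nonneg (n : ℝ)),
        mul_nonneg Real.pi_pos.le (show (0 : ℝ) ≤ n by linarith), mul_self_nonneg (n : ℝ)]
  have e3 : (Real.sqrt (Real.pi * n))⁻¹ / n ≤ w := by
    rw [hw', div_eq_mul_inv, ← mul_inv, mul_comm]
    gcongr
    nlinarith
  -- From `n + 1 ≤ 2n` and `2^{-3/2} ≥ 1/4`; the errors `e2` and `e5` cost one `w` each, whence the
  -- constant 8.
  have e4 : w ≤ 4 * ((n : ℝ) + 1) ^ (-(3 / 2) : ℝ) := by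
    have h2 : (2 * (n : ℝ)) ^ (-(3 / 2) : ℝ) ≤ ((n : ℝ) + 1) ^ (-(3 / 2) : ℝ) :=
      Real.rpow_le_rpow_of_nonpos (by linarith) (by linarith) (by norm_num)
    have h3 : (1 / 4 : ℝ) ≤ 2 ^ (-(3 / 2) : ℝ) := by
      calc (1 / 4 : ℝ) = 2 ^ (-2 : ℝ) := by
            rw [Real.rpow_neg two_pos.le]; norm_num
        _ ≤ _ := Real.rpow_le_rpow_of_exponent_le (by norm_num) (by norm_num)
    rw [Real.mul_rpow two_pos.le (by linarith)] at h2
    have : 0 ≤ w := by rw [hw']; positivity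
    nlinarith
  have e5 := abs_kernelConst_sub_le hn
  rw [e1]
  rw [abs_le] at e2 e5 ⊢
  constructor <;> linarith [e2.1, e2.2, e5.1, e5.2]

/-! ### The limit and the conclusion. -/

theorem tendsto_sqrt_mul_normCentralBinom :
    Tendsto (fun n : ℕ => Real.sqrt n * normCentralBinom n) atTop
      (nhds (1 / Real.sqrt Real.pi)) := by
  have h : Tendsto (fun n : ℕ => n * normCentralBinom n ^ 2) atTop (nhds (1 / Real.pi)) := by
    have hl := (tendsto_natCast_div_add_atTop (𝕜 := ℝ) (1 / 2)).div_const Real.pi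
    refine tendsto_of_tendsto_of_tendsto_of_le_of_le' hl tendsto_const_nhds
      (Eventually.of_forall fun n => ?_) ((eventually_gt_atTop 0).mono fun n hn => ?_)
    · refine le_of_eq_of_le ?_ (mul_le_mul_of_nonneg_left (le_normCentralBinom_sq n) n.cast_nonneg)
      field_simp
    · have hn' : (0 : ℝ) < n := Nat.cast_pos.2 hn
      refine (mul_le_mul_of_nonneg_left (normCentralBinom_sq_le hn) hn'.le).trans_eq ?_
      field_simp
  have h' := h.sqrt
  rw [Real.sqrt_div zero_le_one, Real.sqrt_one] at h'
  refine h'.congr fun n => ?_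
  rw [Real.sqrt_mul n.cast_nonneg, Real.sqrt_sq (normCentralBinom_pos n).le]

theorem mainTheorem2 :
    ((fun r : ℕ =>
        kernelConst r -
          (Real.pi ^ (-(1 / 2) : ℝ) * (2 * (r : ℝ) - 2) ^ (-(1 / 2) : ℝ) +
            Real.sqrt 2 * Real.pi⁻¹ * (4 * (r : ℝ) - 3)⁻¹))
      =O[atTop] fun r : ℕ => (r : ℝ) ^ (-(3 / 2) : ℝ)) ∧
    Tendsto (fun r : ℕ => Real.sqrt (2 * (r : ℝ) - 2) * psiOne (gaussianKernel r))
      atTop (nhds (1 / Real.pi)) := by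
  have hπ : Real.sqrt Real.pi ≠ 0 := by positivity
  constructor
  · refine IsBigO.of_bound 8 ((eventually_ge_atTop 2).mono fun r hr => ?_)
    obtain ⟨n, rfl⟩ : ∃ n, r = n + 1 := ⟨r - 1, by lia⟩
    have h := abs_kernelConst_sub_asymptotic_le (n := n) (by lia)
    push_cast
    rw [show 2 * ((n : ℝ) + 1) - 2 = 2 * n by ring, show 4 * ((n : ℝ) + 1) - 3 = 4 * n + 1 by ring,
      Real.norm_eq_abs, Real.norm_of_nonneg (by positivity)]
    exact h
  · rw [← tendsto_add_atTop_iff_nat 1]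
    have h := ((tendsto_sqrt_mul_normCentralBinom.mul
      (tendsto_oddTail.const_add (Real.sqrt 2 / 2))).const_mul
        (Real.sqrt 2 / Real.sqrt Real.pi))
    have hlim : Real.sqrt 2 / Real.sqrt Real.pi *
        (1 / Real.sqrt Real.pi * (Real.sqrt 2 / 2 + 0)) = 1 / Real.pi := by
      have h1 := Real.mul_self_sqrt (two_pos (α := ℝ)).le
      have h2 := Real.mul_self_sqrt Real.pi_pos.le
      calc _ = (Real.sqrt 2 * Real.sqrt 2) / 2 / (Real.sqrt Real.pi * Real.sqrt Real.pi) := by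
            field_simp
            ring
        _ = _ := by rw [h1, h2]; norm_num
    rw [hlim] at h
    refine h.congr fun n => ?_
    have hk : psiOne (gaussianKernel (n + 1)) = kernelConst (n + 1) / Real.sqrt Real.pi := by
      rw [kernelConst, mul_div_cancel_left₀ _ hπ]
    rw [hk, kernelConst_succ_eq_oddTail]
    push_cast
    rw [show 2 * ((n : ℝ) + 1) - 2 = 2 * n by ring, Real.sqrt_mul two_pos.le]
    ring
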